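/- Let $0<q<p<1$. Alice's coin shows heads with probability $q$, Bob's with probability $p$; each tosses their coin $n$ times, and Alice wins if and only if she gets strictly more heads than Bob, so that her winning probability is \[ f(n)=\sum_{r=0}^{n}\binom nr p^r(1-p)^{n-r}\sum_{s=r+1}^{n}\binom ns q^s(1-q)^{n-s}\qquad(n=0,1,2,\dots). \] The function $f$ attains its maximum over the non-negative integers; let $N(q,p)$ be the smallest $n$ at which it does. Then: 1. $\left\lfloor\frac{1}{2(p-q)}-\frac12\right\rfloor\le N(q,p)$; and if $p+q\ne1$, then $\left\lfloor\frac{1}{2(p-q)}+\frac12\right\rfloor\le N(q,p)$. 2. $N(q,p)\le\left\lceil\frac{\max(1-p,\,q)}{p-q}\right\rceil$. 3. For $n\ge0$ put $\phi_n(z)=\sum_{r=0}^n\binom nr^2z^r$ and, with $x=\frac p{1-p}$ and $y=\frac q{1-q}$, \[ J_n(q,p)=\Bigl(y+\tfrac12(1+xy)\Bigr)\phi_n(xy)-\tfrac12\,\phi_{n+1}(xy). \] For every integer $n\ge1$ and every real $q$ with $0<q<\frac n{2n+1}$, the function $p\mapsto J_n(q,p)$ has a largest zero $p_n(q)$ in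 the interval $[q,1-q]$, and it satisfies $p_n(q)<\frac1{n+1}+\frac{n}{n+1}\,q$. -/

import Mathlib

/-- The probability that Alice gets strictly more heads than Bob when each of them tosses
their coin `n` times, Alice's coin having heads probability `q` and Bob's `p`. -/
noncomputable def winProb (q p : ℝ) (n : ℕ) : ℝ :=
  ∑ r ∈ Finset.range (n + 1), (n.choose r : ℝ) * p ^ r * (1 - p) ^ (n - r) *
    ∑ s ∈ Finset.Ioc r n, (n.choose s : ℝ) * q ^ s * (1 - q) ^ (n - s)

/-- The set of numbers of tosses that maximize Alice's probability of winning. -/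
def optimalLengths (q p : ℝ) : Set ℕ :=
  {n | ∀ m : ℕ, winProb q p m ≤ winProb q p n}

/-- The optimal number of tosses `N(q,p)`, ties going to the lower value. -/
noncomputable def optLen (q p : ℝ) : ℕ :=
  sInf (optimalLengths q p)

/-- `φ_n(z) = ∑_r (n choose r)² z^r`. -/
noncomputable def phiPoly (n : ℕ) (z : ℝ) : ℝ :=
  ∑ r ∈ Finset.range (n + 1), (n.choose r : ℝ) ^ 2 * z ^ r

/-- The indicator function `J_n(q,p)`. -/
noncomputable def indicatorJ (n : ℕ) (q p : ℝ) : ℝ :=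
  let x := p / (1 - p)
  let y := q / (1 - q)
  (y + 1 / 2 * (1 + x * y)) * phiPoly n (x * y) - 1 / 2 * phiPoly (n + 1) (x * y)

/-- The zeros of `J_n(q, ·)` between `q` and `1 - q`. -/
def zerosJ (n : ℕ) (q : ℝ) : Set ℝ :=
  {p | q ≤ p ∧ p ≤ 1 - q ∧ indicatorJ n q p = 0}

/-- The nullcline `p_n(q)`: the largest zero of `J_n(q, ·)` between `q` and `1 - q`. -/
noncomputable def nullcline (n : ℕ) (q : ℝ) : ℝ :=
  sSup (zerosJ n q)

/-! An extra round changes the outcome only if it breaks a tie for Alice or erases a lead of one.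
Hence `f(n+1) - f(n)` is a positive multiple of `J_n = y φ_n(z) - ψ_n(z)`, where `z = xy`
(`winProb_succ_sub`), and everything reduces to comparing `y` with `ψ_n/φ_n`.

The pair `(φ_n, ψ_n)` solves a first-order linear system, so quadratic forms in it satisfy scalar
differential equations. Two such forms vanish at 0 and are positive on `(0,1)` (`upperForm_pos`,
`lowerForm_pos`), which bounds `ψ_n/φ_n` from both sides; `z ↦ 1/z` handles `z > 1`.

In terms of `p` and `q`: `J_n > 0` if `(2n+1)(p-q) ≤ 1`, strictness being needed only on `p + q =
1`, that is `z = 1`; and `J_n ≤ 0` if `n(p-q) ≥ max(1-p, q)`. A maximizer has `J_N ≤ 0`, giving the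
lower bounds; beyond the ceiling `f` no longer increases, giving the upper one. For the nullcline,
`J_n` changes sign between `q` and `1-q` and is negative where `n(p-q) ≥ 1-p`, apart from equality
on `p + q = 1`. -/

/-- `ψ_n(z) = ∑_r (n choose r) (n choose r+1) z^(r+1)`. -/
noncomputable def psiPoly (n : ℕ) (z : ℝ) : ℝ :=
  ∑ r ∈ Finset.range (n + 1), (n.choose r : ℝ) * (n.choose (r + 1) : ℝ) * z ^ (r + 1)

/-- The derivative of `phiPoly n`. -/
noncomputable def phiDeriv (n : ℕ) (z : ℝ) : ℝ :=
  ∑ r ∈ Finset.range (n + 1), (n.choose r : ℝ) ^ 2 * ((r : ℝ) * z ^ (r - 1))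

/-- The derivative of `psiPoly n`. -/
noncomputable def psiDeriv (n : ℕ) (z : ℝ) : ℝ :=
  ∑ r ∈ Finset.range (n + 1),
    (n.choose r : ℝ) * (n.choose (r + 1) : ℝ) * (((r + 1 : ℕ) : ℝ) * z ^ r)

/-! ### The linear differential system and symmetries of `φ_n`, `ψ_n`. -/

lemma hasDerivAt_phiPoly (n : ℕ) (z : ℝ) : HasDerivAt (phiPoly n) (phiDeriv n z) z := by
  unfold phiPoly phiDeriv
  exact HasDerivAt.fun_sum fun r _ => (hasDerivAt_pow r z).const_mul _

lemma hasDerivAt_psiPoly (n : ℕ) (z : ℝ) : HasDerivAt (psiPoly n) (psiDeriv n z) z := by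
  unfold psiPoly psiDeriv
  exact HasDerivAt.fun_sum fun r _ => (hasDerivAt_pow (r + 1) z).const_mul _

lemma choose_succ_mul_cast {n r : ℕ} (h : r ≤ n) :
    (n.choose (r + 1) : ℝ) * (r + 1) = n.choose r * (n - r) := by
  have := congrArg (Nat.cast (R := ℝ)) (Nat.choose_succ_right_eq n r)
  rw [Nat.cast_mul, Nat.cast_mul, Nat.cast_sub h] at this
  exact_mod_cast this

lemma mul_phiDeriv (n : ℕ) (z : ℝ) :
    z * phiDeriv n z = ∑ r ∈ Finset.range (n + 1), (n.choose r : ℝ) ^ 2 * ((r : ℝ) * z ^ r) := by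
  unfold phiDeriv
  rw [Finset.mul_sum]
  refine Finset.sum_congr rfl fun r _ => ?_
  rcases r with _ | r
  · simp
  · simp only [Nat.add_sub_cancel]; ring

lemma psiDeriv_eq (n : ℕ) (z : ℝ) : psiDeriv n z = n * phiPoly n z - z * phiDeriv n z := by
  rw [mul_phiDeriv, phiPoly, psiDeriv, Finset.mul_sum, ← Finset.sum_sub_distrib]
  refine Finset.sum_congr rfl fun r hr => ?_
  have h := choose_succ_mul_cast (Nat.lt_succ_iff.mp (Finset.mem_range.mp hr))
  push_cast
  linear_combination (n.choose r : ℝ) * z ^ r * h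

lemma mul_phiDeriv_add_mul_psiDeriv (n : ℕ) (z : ℝ) :
    z * phiDeriv n z + z * psiDeriv n z = (n + 1) * psiPoly n z := by
  rw [mul_phiDeriv, psiDeriv, psiPoly, Finset.sum_range_succ']
  have h0 : ∑ r ∈ Finset.range n, (n.choose (r + 1) : ℝ) ^ 2 * (((r + 1 : ℕ) : ℝ) * z ^ (r + 1)) =
      ∑ r ∈ Finset.range (n + 1),
        (n.choose (r + 1) : ℝ) ^ 2 * (((r + 1 : ℕ) : ℝ) * z ^ (r + 1)) := by
    rw [Finset.sum_range_succ _ n]; simp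
  rw [h0, Finset.mul_sum, Finset.mul_sum]
  simp only [Nat.cast_zero, zero_mul, mul_zero, add_zero]
  rw [← Finset.sum_add_distrib]
  refine Finset.sum_congr rfl fun r hr => ?_
  have h := choose_succ_mul_cast (Nat.lt_succ_iff.mp (Finset.mem_range.mp hr))
  push_cast
  linear_combination (n.choose (r + 1) : ℝ) * z ^ (r + 1) * h

/-- Square Pascal's rule: the cross terms add up to `2 ψ_n`. -/
lemma phiPoly_succ (n : ℕ) (z : ℝ) :
    phiPoly (n + 1) z = (1 + z) * phiPoly n z + 2 * psiPoly n z := by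
  have h1 : phiPoly n z =
      ∑ r ∈ Finset.range (n + 1), (n.choose (r + 1) : ℝ) ^ 2 * z ^ (r + 1) + 1 := by
    rw [phiPoly, Finset.sum_range_succ', Finset.sum_range_succ _ n]; simp
  have h2 : phiPoly (n + 1) z =
      ∑ r ∈ Finset.range (n + 1), ((n + 1).choose (r + 1) : ℝ) ^ 2 * z ^ (r + 1) + 1 := by
    rw [phiPoly, Finset.sum_range_succ']; simp
  rw [h2, add_mul, one_mul]
  nth_rewrite 1 [h1]
  rw [phiPoly, psiPoly, Finset.mul_sum, Finset.mul_sum]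
  have : ∑ r ∈ Finset.range (n + 1), ((n + 1).choose (r + 1) : ℝ) ^ 2 * z ^ (r + 1) =
      ∑ r ∈ Finset.range (n + 1), (n.choose (r + 1) : ℝ) ^ 2 * z ^ (r + 1) +
      ∑ r ∈ Finset.range (n + 1), z * ((n.choose r : ℝ) ^ 2 * z ^ r) +
      ∑ r ∈ Finset.range (n + 1),
        2 * ((n.choose r : ℝ) * (n.choose (r + 1) : ℝ) * z ^ (r + 1)) := by
    rw [← Finset.sum_add_distrib, ← Finset.sum_add_distrib]
    refine Finset.sum_congr rfl fun r _ => ?_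
    rw [Nat.choose_succ_succ]; push_cast; ring
  rw [this]; ring

lemma indicatorJ_eq (n : ℕ) (q p : ℝ) :
    indicatorJ n q p = q / (1 - q) * phiPoly n (p / (1 - p) * (q / (1 - q))) -
      psiPoly n (p / (1 - p) * (q / (1 - q))) := by
  simp only [indicatorJ, phiPoly_succ]; ring

lemma phiPoly_pos (n : ℕ) {z : ℝ} (hz : 0 ≤ z) : 0 < phiPoly n z := by
  rw [phiPoly, Finset.sum_range_succ']
  have : 0 ≤ ∑ r ∈ Finset.range n, (n.choose (r + 1) : ℝ) ^ 2 * z ^ (r + 1) :=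
    Finset.sum_nonneg fun r _ => by positivity
  simp only [Nat.choose_zero_right, pow_zero, Nat.cast_one]; linarith

lemma psiPoly_nonneg (n : ℕ) {z : ℝ} (hz : 0 ≤ z) : 0 ≤ psiPoly n z :=
  Finset.sum_nonneg fun r _ => by positivity

lemma psiPoly_pos {n : ℕ} (hn : 1 ≤ n) {z : ℝ} (hz : 0 < z) : 0 < psiPoly n z := by
  refine Finset.sum_pos' (fun r _ => by positivity) ⟨0, by simp, ?_⟩
  have : (0 : ℝ) < n := by exact_mod_cast hn
  simp; positivity

lemma psiPoly_apply_zero (n : ℕ) : psiPoly n 0 = 0 := by simp [psiPoly]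

lemma phiPoly_inv (n : ℕ) {z : ℝ} (hz : z ≠ 0) : phiPoly n z = z ^ n * phiPoly n z⁻¹ := by
  rw [phiPoly, phiPoly, ← Finset.sum_flip, Finset.mul_sum]
  refine Finset.sum_congr rfl fun r hr => ?_
  have h : r ≤ n := Nat.lt_succ_iff.mp (Finset.mem_range.mp hr)
  rw [Nat.choose_symm h, inv_pow, pow_sub₀ z hz h]; ring

lemma psiPoly_inv (n : ℕ) {z : ℝ} (hz : z ≠ 0) :
    psiPoly n z = z ^ (n + 1) * psiPoly n z⁻¹ := by
  rw [psiPoly, psiPoly, Finset.sum_range_succ, Finset.sum_range_succ]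
  simp only [Nat.choose_succ_self, Nat.cast_zero, mul_zero, zero_mul, add_zero]
  rw [← Finset.sum_range_reflect, Finset.mul_sum]
  refine Finset.sum_congr rfl fun r hr => ?_
  have h : r < n := Finset.mem_range.mp hr
  have e1 : n - 1 - r + 1 = n - r := by omega
  have e2 : n - 1 - r = n - (r + 1) := by omega
  have e3 : n - r = n + 1 - (r + 1) := by omega
  rw [e1, Nat.choose_symm h.le, e2, Nat.choose_symm h, e3, inv_pow,
    pow_sub₀ z hz (by omega : r + 1 ≤ n + 1)]
  ring

/-! ### Positivity of two quadratic forms in `φ_n`, `ψ_n`. -/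

/-- `n z φ² - (1 + z) / 2 φ ψ - (n + 1) ψ²`, which bounds `ψ / φ` from above when positive. -/
noncomputable def upperForm (n : ℕ) (z : ℝ) : ℝ :=
  n * z * phiPoly n z ^ 2 - (1 + z) / 2 * (phiPoly n z * psiPoly n z) - (n + 1) * psiPoly n z ^ 2

/-- `(n + 1) ψ² + φ ψ - n z φ²`, which bounds `ψ / φ` from below when positive. -/
noncomputable def lowerForm (n : ℕ) (z : ℝ) : ℝ :=
  (n + 1) * psiPoly n z ^ 2 + phiPoly n z * psiPoly n z - n * z * phiPoly n z ^ 2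

lemma mul_phiPoly_one (n : ℕ) : (n : ℝ) * phiPoly n 1 = (n + 1) * psiPoly n 1 := by
  linarith [psiDeriv_eq n 1, mul_phiDeriv_add_mul_psiDeriv n 1]

lemma upperForm_one (n : ℕ) : upperForm n 1 = 0 := by
  rw [upperForm]
  linear_combination (phiPoly n 1 + psiPoly n 1) * mul_phiPoly_one n

lemma lowerForm_one (n : ℕ) : lowerForm n 1 = 0 := by
  rw [lowerForm]
  linear_combination (-phiPoly n 1 - psiPoly n 1) * mul_phiPoly_one n

lemma hasDerivAt_upperForm (n : ℕ) (z : ℝ) : HasDerivAt (upperForm n)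
    (n * phiPoly n z ^ 2 + n * z * (2 * phiPoly n z * phiDeriv n z)
      - (1 / 2 * (phiPoly n z * psiPoly n z) +
        (1 + z) / 2 * (phiDeriv n z * psiPoly n z + phiPoly n z * psiDeriv n z))
      - (n + 1) * (2 * psiPoly n z * psiDeriv n z)) z := by
  have hf := hasDerivAt_phiPoly n z
  have hg := hasDerivAt_psiPoly n z
  have h := ((((hasDerivAt_id z).const_mul (n : ℝ)).mul (hf.pow 2)).sub
    ((((hasDerivAt_id z).const_add 1).div_const 2).mul (hf.mul hg))).sub
    ((hg.pow 2).const_mul ((n : ℝ) + 1))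
  refine h.congr_deriv ?_
  simp

lemma hasDerivAt_lowerForm (n : ℕ) (z : ℝ) : HasDerivAt (lowerForm n)
    ((n + 1) * (2 * psiPoly n z * psiDeriv n z) +
        (phiDeriv n z * psiPoly n z + phiPoly n z * psiDeriv n z)
      - (n * phiPoly n z ^ 2 + n * z * (2 * phiPoly n z * phiDeriv n z))) z := by
  have hf := hasDerivAt_phiPoly n z
  have hg := hasDerivAt_psiPoly n z
  have h := (((hg.pow 2).const_mul ((n : ℝ) + 1)).add (hf.mul hg)).sub
    (((hasDerivAt_id z).const_mul (n : ℝ)).mul (hf.pow 2))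
  refine h.congr_deriv ?_
  simp

lemma one_sub_mul_phiDeriv (n : ℕ) (z : ℝ) :
    (1 - z) * (z * phiDeriv n z) = (n + 1) * psiPoly n z - n * z * phiPoly n z := by
  linear_combination mul_phiDeriv_add_mul_psiDeriv n z - z * psiDeriv_eq n z

lemma one_sub_mul_psiDeriv (n : ℕ) (z : ℝ) :
    (1 - z) * (z * psiDeriv n z) = n * z * phiPoly n z - (n + 1) * z * psiPoly n z := by
  linear_combination -z * mul_phiDeriv_add_mul_psiDeriv n z + z * psiDeriv_eq n z

/-- The coefficient `(1 + z) / 2` in the form leaves a remainder with no `φ²` or `ψ²` term and a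
visible sign. -/
lemma upperForm_ode (n : ℕ) (z : ℝ) :
    (1 - z) * z * deriv (upperForm n) z = (1 / 2 - (2 * n + 3 / 2) * z) * upperForm n z
      + (1 - z) ^ 2 / 4 * (phiPoly n z * psiPoly n z) := by
  rw [(hasDerivAt_upperForm n z).deriv, upperForm]
  linear_combination (n * z * (2 * phiPoly n z) - (1 + z) / 2 * psiPoly n z) *
      one_sub_mul_phiDeriv n z +
    (-(1 + z) / 2 * phiPoly n z - (n + 1) * (2 * psiPoly n z)) * one_sub_mul_psiDeriv n z

lemma lowerForm_ode (n : ℕ) (z : ℝ) :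
    (1 - z) * z * deriv (lowerForm n) z = -(2 * n + 1) * z * lowerForm n z
      + (n + 1) * (1 - z) * psiPoly n z ^ 2 := by
  rw [(hasDerivAt_lowerForm n z).deriv, lowerForm]
  linear_combination (psiPoly n z - n * z * (2 * phiPoly n z)) * one_sub_mul_phiDeriv n z +
    ((n + 1) * (2 * psiPoly n z) + phiPoly n z) * one_sub_mul_psiDeriv n z

lemma upperForm_apply_zero (n : ℕ) : upperForm n 0 = 0 := by
  simp [upperForm, psiPoly_apply_zero]

lemma lowerForm_apply_zero (n : ℕ) : lowerForm n 0 = 0 := by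
  simp [lowerForm, psiPoly_apply_zero]

lemma deriv_upperForm_pos {n : ℕ} (hn : 1 ≤ n) {z : ℝ} (h0 : 0 ≤ z) (h1 : z < 1)
    (h : upperForm n z = 0) : 0 < deriv (upperForm n) z := by
  have hn' : (0 : ℝ) < n := by exact_mod_cast hn
  rcases h0.eq_or_lt with rfl | h0
  -- The differential equation degenerates at 0; there the derivative is `n φ(0)² / 2`.
  · rw [(hasDerivAt_upperForm n 0).deriv, psiDeriv_eq, psiPoly_apply_zero]
    have := phiPoly_pos n (le_refl (0 : ℝ))
    have : 0 < n * phiPoly n 0 ^ 2 := by positivity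
    linarith
  · have hode := upperForm_ode n z
    have hp := phiPoly_pos n h0.le
    have hq := psiPoly_pos hn h0
    have h1' : 0 < 1 - z := by linarith
    rw [h, mul_zero, zero_add] at hode
    have : 0 < (1 - z) * z * deriv (upperForm n) z := by rw [hode]; positivity
    exact pos_of_mul_pos_right this (by positivity)

/-- The form starts at 0 and increases through each of its zeros, so it cannot become negative; an
interior zero would then be a minimum with positive slope. -/
lemma upperForm_pos_of_lt_one {n : ℕ} (hn : 1 ≤ n) {z : ℝ} (h0 : 0 < z) (h1 : z < 1) :
    0 < upperForm n z := by
  have hdiff : Differentiable ℝ (upperForm n) := fun z =>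
    (hasDerivAt_upperForm n z).differentiableAt
  have key : ∀ w, 0 ≤ w → w < 1 → 0 ≤ upperForm n w := by
    intro w hw0 hw1
    have := image_le_of_deriv_right_lt_deriv_boundary (a := 0) (b := w)
      (f := fun t => -upperForm n t) (f' := fun t => -deriv (upperForm n) t)
      (B := fun _ => 0) (B' := fun _ => 0) hdiff.continuous.neg.continuousOn
      (fun t _ => (hdiff t).hasDerivAt.neg.hasDerivWithinAt)
      (by simp [upperForm_apply_zero]) (fun t => hasDerivAt_const t 0)
      (fun t ht h => neg_lt_zero.mpr
        (deriv_upperForm_pos hn ht.1 (ht.2.trans hw1) (neg_eq_zero.mp h)))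
      (Set.right_mem_Icc.mpr hw0)
    linarith
  refine (key z h0.le h1).lt_of_ne fun h => ?_
  have hmin : IsLocalMin (upperForm n) z := by
    filter_upwards [Ioo_mem_nhds h0 h1] with w hw
    rw [← h]; exact key w hw.1.le hw.2
  exact (deriv_upperForm_pos hn h0.le h1 h.symm).ne' hmin.deriv_eq_zero

lemma upperForm_inv (n : ℕ) {z : ℝ} (hz : z ≠ 0) :
    upperForm n z = z ^ (2 * n + 2) * upperForm n z⁻¹ := by
  rw [upperForm, upperForm, phiPoly_inv n hz, psiPoly_inv n hz]
  field_simp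
  ring

lemma upperForm_pos {n : ℕ} (hn : 1 ≤ n) {z : ℝ} (h0 : 0 < z) (h1 : z ≠ 1) :
    0 < upperForm n z := by
  rcases h1.lt_or_gt with h1 | h1
  · exact upperForm_pos_of_lt_one hn h0 h1
  · rw [upperForm_inv n h0.ne']
    have := upperForm_pos_of_lt_one hn (inv_pos.mpr h0) (inv_lt_one_of_one_lt₀ h1)
    positivity

/-- Dividing by `(1 - t)^(2n+1)`, the solution of the homogeneous equation, leaves a function with
positive derivative. -/
lemma lowerForm_pos {n : ℕ} (hn : 1 ≤ n) {z : ℝ} (h0 : 0 < z) (h1 : z < 1) :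
    0 < lowerForm n z := by
  have hdiff : Differentiable ℝ (lowerForm n) := fun z =>
    (hasDerivAt_lowerForm n z).differentiableAt
  have hd : ∀ t ∈ Set.Icc 0 z, HasDerivAt (fun t => lowerForm n t / (1 - t) ^ (2 * n + 1))
      ((deriv (lowerForm n) t * (1 - t) ^ (2 * n + 1) -
        lowerForm n t * (((2 * n + 1 : ℕ) : ℝ) * (1 - t) ^ (2 * n) * -1)) /
          ((1 - t) ^ (2 * n + 1)) ^ 2) t := by
    intro t ht
    have ht1 : 0 < 1 - t := by linarith [ht.2]
    have h := ((hasDerivAt_id t).const_sub 1).pow (2 * n + 1)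
    exact (hdiff t).hasDerivAt.div h (by simp; positivity)
  have hmono : StrictMonoOn (fun t => lowerForm n t / (1 - t) ^ (2 * n + 1)) (Set.Icc 0 z) := by
    refine strictMonoOn_of_deriv_pos (convex_Icc 0 z)
      (fun t ht => (hd t ht).continuousAt.continuousWithinAt) fun t ht => ?_
    rw [interior_Icc] at ht
    rw [(hd t ⟨ht.1.le, ht.2.le⟩).deriv]
    have ht0 := ht.1
    have ht1 : 0 < 1 - t := by linarith [ht.2]
    have hq := psiPoly_pos hn ht0
    refine div_pos (pos_of_mul_pos_right (a := t) ?_ ht0.le) (by positivity)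
    have : t * (deriv (lowerForm n) t * (1 - t) ^ (2 * n + 1) -
        lowerForm n t * (((2 * n + 1 : ℕ) : ℝ) * (1 - t) ^ (2 * n) * -1)) =
        (1 - t) ^ (2 * n) * ((n + 1) * (1 - t) * psiPoly n t ^ 2) := by
      push_cast
      linear_combination (1 - t) ^ (2 * n) * lowerForm_ode n t
    rw [this]; positivity
  have h := hmono (Set.left_mem_Icc.mpr h0.le) (Set.right_mem_Icc.mpr h0.le) h0
  simp only [lowerForm_apply_zero, zero_div] at h
  have : 0 < 1 - z := by linarith
  exact (div_pos_iff_of_pos_right (by positivity)).mp h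

/-! ### Sign of `J_n`, first in odds and then in probabilities. -/

lemma psiPoly_lt {n : ℕ} {x y : ℝ} (hx : 0 < x) (hy : 0 < y)
    (h : 2 * n * x ≤ 1 + x * y + (2 * n + 2) * y)
    (h1 : x * y ≠ 1 ∨ 2 * n * x < 1 + x * y + (2 * n + 2) * y) :
    psiPoly n (x * y) < y * phiPoly n (x * y) := by
  have hz : 0 < x * y := mul_pos hx hy
  have hφ := phiPoly_pos n hz.le
  rcases n.eq_zero_or_pos with rfl | hn
  · simpa [psiPoly] using mul_pos hy hφ
  by_contra! hle
  have hyφ : 0 < y * phiPoly n (x * y) := mul_pos hy hφ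
  have e1 : (1 + x * y) * (y * phiPoly n (x * y)) * phiPoly n (x * y) ≤
      (1 + x * y) * psiPoly n (x * y) * phiPoly n (x * y) := by gcongr
  have e2 : (2 * n + 2) * (y * phiPoly n (x * y)) ^ 2 ≤
      (2 * n + 2) * psiPoly n (x * y) ^ 2 := by gcongr
  have hc : 0 < y * phiPoly n (x * y) ^ 2 := by positivity
  -- The form decreases in `ψ`, so `ψ` may be replaced by `y φ`; a factor `y φ²` then splits off.
  have hH : 2 * upperForm n (x * y) ≤
      (2 * n * x - (1 + x * y + (2 * n + 2) * y)) * (y * phiPoly n (x * y) ^ 2) := by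
    rw [upperForm]; linarith
  by_cases hz1 : x * y = 1
  · have hlt := h1.resolve_left (not_not_intro hz1)
    have := mul_neg_of_neg_of_pos (sub_neg.mpr hlt) hc
    rw [show upperForm n (x * y) = 0 by rw [hz1, upperForm_one]] at hH
    linarith
  · have := mul_nonpos_of_nonpos_of_nonneg (sub_nonpos.mpr h) hc.le
    linarith [upperForm_pos hn hz hz1]

lemma le_psiPoly {n : ℕ} {x y : ℝ} (hx : 0 < x) (hy : 0 < y) (hz1 : x * y ≤ 1)
    (h : 1 + (n + 1) * y ≤ n * x) : y * phiPoly n (x * y) ≤ psiPoly n (x * y) ∧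
      (x * y < 1 ∨ 1 + (n + 1) * y < n * x → y * phiPoly n (x * y) < psiPoly n (x * y)) := by
  have hz : 0 < x * y := mul_pos hx hy
  have hφ := phiPoly_pos n hz.le
  have hψ := psiPoly_nonneg n hz.le
  have hn : 1 ≤ n := by
    rcases n.eq_zero_or_pos with rfl | hn
    · simp at h; linarith
    · exact hn
  have hL : 0 ≤ lowerForm n (x * y) := by
    rcases hz1.eq_or_lt with h1 | h1
    · rw [h1, lowerForm_one]
    · exact (lowerForm_pos hn hz h1).le
  have hc : 0 < y * phiPoly n (x * y) ^ 2 := by positivity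
  have hh := mul_nonneg (sub_nonneg.mpr h) hc.le
  constructor
  · by_contra! hlt
    have e1 : psiPoly n (x * y) * phiPoly n (x * y) <
        y * phiPoly n (x * y) * phiPoly n (x * y) := by gcongr
    have e2 : (n + 1) * psiPoly n (x * y) ^ 2 ≤ (n + 1) * (y * phiPoly n (x * y)) ^ 2 := by gcongr
    rw [lowerForm] at hL
    linarith
  · intro hs
    by_contra! hle
    have e1 : psiPoly n (x * y) * phiPoly n (x * y) ≤
        y * phiPoly n (x * y) * phiPoly n (x * y) := by gcongr
    have e2 : (n + 1) * psiPoly n (x * y) ^ 2 ≤ (n + 1) * (y * phiPoly n (x * y)) ^ 2 := by gcongr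
    rcases hs with hs | hs
    · have := lowerForm_pos hn hz hs
      rw [lowerForm] at this
      linarith
    · have := mul_pos (sub_pos.mpr hs) hc
      rw [lowerForm] at hL
      linarith

/-- Apply `le_psiPoly` to `(1/y, 1/x)`: swapping heads with tails and the players inverts `z`. -/
lemma le_psiPoly_of_one_le {n : ℕ} {x y : ℝ} (hx : 0 < x) (hy : 0 < y) (hz1 : 1 ≤ x * y)
    (h : (n + 1) * y + x * y ≤ n * x) : y * phiPoly n (x * y) ≤ psiPoly n (x * y) := by
  have hz : 0 < x * y := mul_pos hx hy
  have hinv : y⁻¹ * x⁻¹ = (x * y)⁻¹ := by rw [mul_inv, mul_comm]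
  have key := (le_psiPoly (n := n) (inv_pos.mpr hy) (inv_pos.mpr hx)
    (by rw [hinv]; exact inv_le_one_of_one_le₀ hz1) (by
      have : ((n + 1) * y + x * y) / (x * y) ≤ n * x / (x * y) := by gcongr
      convert this using 1 <;> field_simp
      ring)).1
  rw [hinv] at key
  rw [phiPoly_inv n hz.ne', psiPoly_inv n hz.ne']
  have := mul_le_mul_of_nonneg_left key (pow_pos hz (n + 1)).le
  refine le_trans (le_of_eq ?_) this
  rw [pow_succ]; field_simp

/-- After multiplication by `(1-p)(1-q)`, right side minus left is exactly `1 - (2n+1)(p-q)`. -/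
lemma odds_sub_le_iff {q p : ℝ} (hq : q < 1) (hp : p < 1) (n : ℕ) :
    2 * n * (p / (1 - p)) ≤ 1 + p / (1 - p) * (q / (1 - q)) + (2 * n + 2) * (q / (1 - q)) ↔
      (2 * n + 1) * (p - q) ≤ 1 := by
  have h1 : 0 < 1 - p := by linarith
  have h2 : 0 < 1 - q := by linarith
  rw [← mul_le_mul_iff_left₀ (mul_pos h1 h2), ← sub_nonneg, ← sub_nonneg (a := (1 : ℝ))]
  refine iff_of_eq (congrArg _ ?_)
  field_simp
  ring

lemma odds_sub_lt_iff {q p : ℝ} (hq : q < 1) (hp : p < 1) (n : ℕ) :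
    2 * n * (p / (1 - p)) < 1 + p / (1 - p) * (q / (1 - q)) + (2 * n + 2) * (q / (1 - q)) ↔
      (2 * n + 1) * (p - q) < 1 := by
  have h1 : 0 < 1 - p := by linarith
  have h2 : 0 < 1 - q := by linarith
  rw [← mul_lt_mul_iff_left₀ (mul_pos h1 h2), ← sub_pos, ← sub_pos (a := (1 : ℝ))]
  refine iff_of_eq (congrArg _ ?_)
  field_simp
  ring

lemma one_sub_odds_mul_odds {q p : ℝ} (hq : q < 1) (hp : p < 1) :
    1 - p / (1 - p) * (q / (1 - q)) = (1 - p - q) / ((1 - p) * (1 - q)) := by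
  have h1 : 1 - p ≠ 0 := by linarith
  have h2 : 1 - q ≠ 0 := by linarith
  field_simp
  ring

lemma odds_sub_upper {q p : ℝ} (hq : q < 1) (hp : p < 1) (n : ℕ) :
    n * (p / (1 - p)) - (1 + (n + 1) * (q / (1 - q))) =
      (n * (p - q) - (1 - p)) / ((1 - p) * (1 - q)) := by
  have h1 : 1 - p ≠ 0 := by linarith
  have h2 : 1 - q ≠ 0 := by linarith
  field_simp
  ring

lemma odds_sub_upper' {q p : ℝ} (hq : q < 1) (hp : p < 1) (n : ℕ) :
    n * (p / (1 - p)) - ((n + 1) * (q / (1 - q)) + p / (1 - p) * (q / (1 - q))) =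
      (n * (p - q) - q) / ((1 - p) * (1 - q)) := by
  have h1 : 1 - p ≠ 0 := by linarith
  have h2 : 1 - q ≠ 0 := by linarith
  field_simp
  ring

lemma indicatorJ_pos {n : ℕ} {q p : ℝ} (hq0 : 0 < q) (hq : q < 1) (hp0 : 0 < p) (hp : p < 1)
    (h : (2 * n + 1) * (p - q) ≤ 1) (h1 : p + q ≠ 1 ∨ (2 * n + 1) * (p - q) < 1) :
    0 < indicatorJ n q p := by
  rw [indicatorJ_eq, sub_pos]
  have h1p : 0 < 1 - p := by linarith
  have h1q : 0 < 1 - q := by linarith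
  refine psiPoly_lt (div_pos hp0 h1p) (div_pos hq0 h1q) ((odds_sub_le_iff hq hp n).mpr h) ?_
  rw [odds_sub_lt_iff hq hp n]
  refine h1.imp_left fun hne heq => ?_
  have := one_sub_odds_mul_odds hq hp
  rw [heq, sub_self, eq_comm, div_eq_zero_iff, or_iff_left (mul_pos h1p h1q).ne'] at this
  exact hne (by linarith)

lemma indicatorJ_nonpos {n : ℕ} {q p : ℝ} (hq0 : 0 < q) (hq : q < 1) (hp0 : 0 < p) (hp : p < 1)
    (h : max (1 - p) q ≤ n * (p - q)) : indicatorJ n q p ≤ 0 := by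
  rw [indicatorJ_eq, sub_nonpos]
  have h1p : 0 < 1 - p := by linarith
  have h1q : 0 < 1 - q := by linarith
  have hc := mul_pos h1p h1q
  rcases le_total (p + q) 1 with hpq | hpq
  · refine (le_psiPoly (div_pos hp0 h1p) (div_pos hq0 h1q) ?_ ?_).1
    · rw [← sub_nonneg, one_sub_odds_mul_odds hq hp]
      exact div_nonneg (by linarith) hc.le
    · rw [← sub_nonneg, odds_sub_upper hq hp]
      exact div_nonneg (by linarith [le_max_left (1 - p) q]) hc.le
  · refine le_psiPoly_of_one_le (div_pos hp0 h1p) (div_pos hq0 h1q) ?_ ?_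
    · rw [← sub_nonpos, one_sub_odds_mul_odds hq hp]
      exact div_nonpos_of_nonpos_of_nonneg (by linarith) hc.le
    · rw [← sub_nonneg, odds_sub_upper' hq hp]
      exact div_nonneg (by linarith [le_max_right (1 - p) q]) hc.le

lemma indicatorJ_neg {n : ℕ} {q p : ℝ} (hq0 : 0 < q) (hq : q < 1) (hp0 : 0 < p) (hp : p < 1)
    (hpq : p + q ≤ 1) (h : 1 - p ≤ n * (p - q)) (hs : p + q < 1 ∨ 1 - p < n * (p - q)) :
    indicatorJ n q p < 0 := by
  rw [indicatorJ_eq, sub_neg]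
  have h1p : 0 < 1 - p := by linarith
  have h1q : 0 < 1 - q := by linarith
  have hc := mul_pos h1p h1q
  refine (le_psiPoly (div_pos hp0 h1p) (div_pos hq0 h1q) ?_ ?_).2 (hs.imp (fun hs => ?_) fun hs => ?_)
  · rw [← sub_nonneg, one_sub_odds_mul_odds hq hp]
    exact div_nonneg (by linarith) hc.le
  · rw [← sub_nonneg, odds_sub_upper hq hp]
    exact div_nonneg (by linarith) hc.le
  · rw [← sub_pos, one_sub_odds_mul_odds hq hp]
    exact div_pos (by linarith) hc
  · rw [← sub_pos, odds_sub_upper hq hp]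
    exact div_pos (by linarith) hc

/-! ### Increments of the winning probability. -/

/-- The probability of exactly `r` heads in `n` tosses of a coin with heads probability `t`. -/
noncomputable def binomProb (t : ℝ) (n r : ℕ) : ℝ :=
  (n.choose r : ℝ) * t ^ r * (1 - t) ^ (n - r)

/-- The probability of more than `r` heads in `n` tosses of a coin with heads probability `t`. -/
noncomputable def binomTail (t : ℝ) (n r : ℕ) : ℝ :=
  ∑ s ∈ Finset.Ioc r n, binomProb t n s

lemma binomProb_eq_zero (t : ℝ) {n r : ℕ} (h : n < r) : binomProb t n r = 0 := by
  simp [binomProb, Nat.choose_eq_zero_of_lt h]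

lemma binomProb_succ_zero (t : ℝ) (n : ℕ) :
    binomProb t (n + 1) 0 = (1 - t) * binomProb t n 0 := by
  simp [binomProb, pow_succ']

lemma binomProb_succ_succ (t : ℝ) (n r : ℕ) :
    binomProb t (n + 1) (r + 1) = (1 - t) * binomProb t n (r + 1) + t * binomProb t n r := by
  rcases lt_trichotomy n r with h | rfl | h
  · rw [binomProb_eq_zero t h, binomProb_eq_zero t (by omega : n < r + 1),
      binomProb_eq_zero t (by omega)]
    ring
  · rw [binomProb_eq_zero t (by omega : n < n + 1)]
    simp [binomProb, pow_succ']
  · rw [binomProb, binomProb, binomProb, Nat.choose_succ_succ,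
      (by omega : n + 1 - (r + 1) = n - r), (by omega : n - r = n - (r + 1) + 1)]
    push_cast
    ring

lemma binomTail_succ_right (t : ℝ) (n r : ℕ) :
    binomTail t n (r + 1) = binomTail t n r - binomProb t n (r + 1) := by
  rcases lt_or_ge r n with h | h
  · rw [binomTail, binomTail, ← Finset.sum_Ioc_consecutive _ (Nat.le_succ r) h]
    simp
  · rw [binomTail, binomTail, Finset.Ioc_eq_empty_of_le h, Finset.Ioc_eq_empty_of_le (by omega),
      binomProb_eq_zero t (by omega)]
    simp

lemma binomTail_eq_zero (t : ℝ) {n r : ℕ} (h : n ≤ r) : binomTail t n r = 0 := by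
  rw [binomTail, Finset.Ioc_eq_empty_of_le h, Finset.sum_empty]

lemma binomTail_succ_left (t : ℝ) (n r : ℕ) :
    binomTail t (n + 1) r = binomTail t n r + t * binomProb t n r := by
  rcases le_or_gt r (n + 1) with h | h
  · induction h using Nat.decreasingInduction with
    | self =>
      rw [binomTail_eq_zero t le_rfl, binomTail_eq_zero t (by omega), binomProb_eq_zero t (by omega)]
      simp
    | of_succ k hk ih =>
      rw [binomTail_succ_right, binomTail_succ_right, binomProb_succ_succ] at ih
      linarith
  · rw [binomTail_eq_zero t h.le, binomTail_eq_zero t (by omega), binomProb_eq_zero t (by omega)]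
    simp

lemma winProb_eq (q p : ℝ) (n : ℕ) :
    winProb q p n = ∑ r ∈ Finset.range (n + 1), binomProb p n r * binomTail q n r := rfl

lemma sum_binomProb_succ (p : ℝ) (n : ℕ) (g : ℕ → ℝ) :
    ∑ r ∈ Finset.range (n + 2), binomProb p (n + 1) r * g r =
      ∑ r ∈ Finset.range (n + 1), binomProb p n r * ((1 - p) * g r + p * g (r + 1)) := by
  rw [Finset.sum_range_succ', binomProb_succ_zero]
  have h : ∑ r ∈ Finset.range (n + 1), binomProb p n r * ((1 - p) * g r) =
      ∑ r ∈ Finset.range (n + 1), (1 - p) * binomProb p n (r + 1) * g (r + 1) +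
        (1 - p) * binomProb p n 0 * g 0 := by
    rw [Finset.sum_range_succ', Finset.sum_range_succ _ n, binomProb_eq_zero p (Nat.lt_succ_self n)]
    simp only [mul_zero, zero_mul, add_zero]
    congr 1
    · exact Finset.sum_congr rfl fun r _ => by ring
    · ring
  simp only [mul_add, Finset.sum_add_distrib]
  rw [h, add_right_comm, ← Finset.sum_add_distrib]
  congr 1
  refine Finset.sum_congr rfl fun r _ => ?_
  rw [binomProb_succ_succ]; ring

/-- Conditioning on the last round, the term for Bob's `r` heads has weight `(1-p) q P(A = r) - p
(1-q) P(A = r+1)`, with `A` Alice's count after `n` tosses. -/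
lemma winProb_succ_sub (n : ℕ) {q p : ℝ} (hq : q < 1) (hp : p < 1) :
    winProb q p (n + 1) - winProb q p n =
      ((1 - p) * (1 - q)) ^ (n + 1) * indicatorJ n q p := by
  have h1 : 1 - p ≠ 0 := by linarith
  have h2 : 1 - q ≠ 0 := by linarith
  rw [winProb_eq, winProb_eq, sum_binomProb_succ, ← Finset.sum_sub_distrib, indicatorJ_eq, phiPoly,
    psiPoly, Finset.mul_sum, ← Finset.sum_sub_distrib, Finset.mul_sum]
  refine Finset.sum_congr rfl fun r hr => ?_
  have hr : r ≤ n := Nat.lt_succ_iff.mp (Finset.mem_range.mp hr)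
  rw [binomTail_succ_left, binomTail_succ_left, binomTail_succ_right]
  obtain ⟨m, rfl⟩ := Nat.exists_eq_add_of_le hr
  -- For `r = n` the exponent `n - (r + 1)` truncates, but its binomial coefficient vanishes.
  rcases m with _ | m
  · rw [binomProb_eq_zero q (by omega : r + 0 < r + 1)]
    simp only [binomProb, add_zero, Nat.choose_self, Nat.choose_succ_self, Nat.sub_self]
    simp only [mul_pow, div_pow, pow_succ]
    field_simp
    push_cast
    ring
  · simp only [binomProb, (by omega : r + (m + 1) - r = m + 1),
      (by omega : r + (m + 1) - (r + 1) = m)]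
    simp only [mul_pow, div_pow, pow_succ, pow_add]
    field_simp
    ring

lemma winProb_lt_succ {n : ℕ} {q p : ℝ} (hq : q < 1) (hp : p < 1) (h : 0 < indicatorJ n q p) :
    winProb q p n < winProb q p (n + 1) := by
  rw [← sub_pos, winProb_succ_sub n hq hp]
  have : 0 < (1 - p) * (1 - q) := mul_pos (by linarith) (by linarith)
  positivity

lemma winProb_succ_le {n : ℕ} {q p : ℝ} (hq : q < 1) (hp : p < 1) (h : indicatorJ n q p ≤ 0) :
    winProb q p (n + 1) ≤ winProb q p n := by
  rw [← sub_nonpos, winProb_succ_sub n hq hp]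
  have : 0 < (1 - p) * (1 - q) := mul_pos (by linarith) (by linarith)
  exact mul_nonpos_of_nonneg_of_nonpos (by positivity) h

lemma exists_optimal_le {q p : ℝ} (hq0 : 0 < q) (hqp : q < p) (hp : p < 1) (U : ℕ)
    (hU : max (1 - p) q ≤ U * (p - q)) : ∃ N ≤ U, N ∈ optimalLengths q p := by
  have hstep : ∀ n, U ≤ n → winProb q p n ≤ winProb q p U := by
    intro n hn
    induction n, hn using Nat.le_induction with
    | base => exact le_rfl
    | succ n hn ih =>
      refine (winProb_succ_le (hqp.trans hp) hp ?_).trans ih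
      refine indicatorJ_nonpos hq0 (hqp.trans hp) (hq0.trans hqp) hp (hU.trans ?_)
      have : (U : ℝ) ≤ n := by exact_mod_cast hn
      exact mul_le_mul_of_nonneg_right this (by linarith)
  obtain ⟨N, hN, hmax⟩ := Finset.exists_max_image (Finset.range (U + 1)) (winProb q p) ⟨0, by simp⟩
  refine ⟨N, Nat.lt_succ_iff.mp (Finset.mem_range.mp hN), fun m => ?_⟩
  rcases le_total m U with h | h
  · exact hmax m (Finset.mem_range.mpr (Nat.lt_succ_of_le h))
  · exact (hstep m h).trans (hmax U (by simp))

/-! ### The nullcline and the final assembly. -/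

lemma continuousAt_indicatorJ (n : ℕ) (q : ℝ) {p : ℝ} (hp : p < 1) :
    ContinuousAt (indicatorJ n q) p := by
  have hx : ContinuousAt (fun p : ℝ => p / (1 - p) * (q / (1 - q))) p :=
    (continuousAt_id.div (by fun_prop) (by simp; linarith)).mul continuousAt_const
  have hJ : indicatorJ n q = fun p =>
      q / (1 - q) * phiPoly n (p / (1 - p) * (q / (1 - q))) -
        psiPoly n (p / (1 - p) * (q / (1 - q))) := funext (indicatorJ_eq n q)
  rw [hJ]
  exact (continuousAt_const.mul ((hasDerivAt_phiPoly n _).continuousAt.comp_of_eq hx rfl)).sub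
    ((hasDerivAt_psiPoly n _).continuousAt.comp_of_eq hx rfl)

lemma isGreatest_nullcline {n : ℕ} {q : ℝ} (hq0 : 0 < q)
    (hq : q < (n : ℝ) / (2 * (n : ℝ) + 1)) : IsGreatest (zerosJ n q) (nullcline n q) := by
  have hc : (0 : ℝ) < 2 * n + 1 := by positivity
  rw [lt_div_iff₀ hc] at hq
  have hn : (0 : ℝ) ≤ n := n.cast_nonneg
  have hq2 : 2 * q < 1 := by
    by_contra! h
    nlinarith
  have hcont : ContinuousOn (indicatorJ n q) (Set.Icc q (1 - q)) := fun p hp =>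
    (continuousAt_indicatorJ n q (by linarith [hp.2])).continuousWithinAt
  have hset : zerosJ n q = Set.Icc q (1 - q) ∩ indicatorJ n q ⁻¹' {0} := by
    ext p; simp [zerosJ, and_assoc]
  have hleft : 0 < indicatorJ n q q :=
    indicatorJ_pos hq0 (by linarith) hq0 (by linarith) (by simp) (Or.inr (by simp))
  have hright : indicatorJ n q (1 - q) < 0 :=
    indicatorJ_neg hq0 (by linarith) (by linarith) (by linarith) (by linarith) (by linarith)
      (Or.inr (by linarith))
  obtain ⟨p, hp, hp0⟩ := intermediate_value_Icc' (by linarith : q ≤ 1 - q) hcont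
    ⟨hright.le, hleft.le⟩
  refine IsCompact.isGreatest_sSup ?_ ⟨p, hp.1, hp.2, hp0⟩
  rw [hset]
  exact isCompact_Icc.of_isClosed_subset
    (hcont.preimage_isClosed_of_isClosed isClosed_Icc isClosed_singleton) Set.inter_subset_left

lemma lt_of_mem_zerosJ {n : ℕ} {q p : ℝ} (hq0 : 0 < q)
    (hq : q < (n : ℝ) / (2 * (n : ℝ) + 1)) (hp : p ∈ zerosJ n q) :
    p < 1 / ((n : ℝ) + 1) + (n : ℝ) * q / ((n : ℝ) + 1) := by
  have hc : (0 : ℝ) < 2 * n + 1 := by positivity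
  have hc' : (0 : ℝ) < n + 1 := by positivity
  rw [lt_div_iff₀ hc] at hq
  obtain ⟨h1, h2, h3⟩ := hp
  by_contra! h
  rw [← add_div, div_le_iff₀ hc'] at h
  refine (indicatorJ_neg (n := n) hq0 (by linarith) (by linarith) (by linarith) (by linarith)
    (by linarith) ?_).ne h3
  -- At `p = 1 - q` the required strict inequality `q < n (1 - 2q)` is the hypothesis on `q`.
  rcases h2.lt_or_eq with h2 | h2
  · exact Or.inl (by linarith)
  · exact Or.inr (by rw [h2]; linarith)

theorem theorem3 :
    (∀ q p : ℝ, 0 < q → q < p → p < 1 →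
      IsLeast (optimalLengths q p) (optLen q p) ∧
      ⌊1 / (2 * (p - q)) - 1 / 2⌋ ≤ (optLen q p : ℤ) ∧
      (p + q ≠ 1 → ⌊1 / (2 * (p - q)) + 1 / 2⌋ ≤ (optLen q p : ℤ)) ∧
      (optLen q p : ℤ) ≤ ⌈max (1 - p) q / (p - q)⌉) ∧
    (∀ (n : ℕ) (q : ℝ), 1 ≤ n → 0 < q → q < (n : ℝ) / (2 * (n : ℝ) + 1) →
      IsGreatest (zerosJ n q) (nullcline n q) ∧
      nullcline n q < 1 / ((n : ℝ) + 1) + (n : ℝ) * q / ((n : ℝ) + 1)) := by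
  refine ⟨fun q p hq0 hqp hp => ?_, fun n q _ hq0 hq => ?_⟩
  · have hd : 0 < p - q := sub_pos.mpr hqp
    have hq1 := hqp.trans hp
    have hp0 := hq0.trans hqp
    obtain ⟨N, hNU, hN⟩ := exists_optimal_le hq0 hqp hp ⌈max (1 - p) q / (p - q)⌉₊
      ((div_le_iff₀ hd).mp (Nat.le_ceil _))
    -- An empty set would have infimum 0 by default, so a maximizer is needed first.
    have hmem : optLen q p ∈ optimalLengths q p := Nat.sInf_mem ⟨N, hN⟩
    have hJ : ¬ 0 < indicatorJ (optLen q p) q p := fun h =>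
      (winProb_lt_succ hq1 hp h).not_ge (hmem _)
    refine ⟨⟨hmem, fun m hm => Nat.sInf_le hm⟩, ?_, fun hne => ?_, ?_⟩
    -- Failure gives `(2N+3)(p-q) ≤ 1`, hence strictness for `2N+1`, so `p + q = 1` is allowed; the
    -- sharper bound below gives only `(2N+1)(p-q) ≤ 1`.
    · by_contra! h
      have h := Int.le_floor.mp (Int.add_one_le_of_lt h)
      push_cast at h
      rw [le_sub_iff_add_le, le_div_iff₀ (by positivity)] at h
      exact hJ (indicatorJ_pos hq0 hq1 hp0 hp (by linarith) (Or.inr (by linarith)))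
    · by_contra! h
      have h := Int.le_floor.mp (Int.add_one_le_of_lt h)
      push_cast at h
      rw [← sub_le_iff_le_add, le_div_iff₀ (by positivity)] at h
      exact hJ (indicatorJ_pos hq0 hq1 hp0 hp (by linarith) (Or.inl hne))
    · have hnn : 0 ≤ max (1 - p) q / (p - q) :=
        div_nonneg (hq0.le.trans (le_max_right _ _)) hd.le
      rw [← Int.natCast_ceil_eq_ceil hnn]
      exact_mod_cast (Nat.sInf_le hN).trans hNU
  · have h := isGreatest_nullcline hq0 hq
    exact ⟨h, lt_of_mem_zerosJ hq0 hq h.1⟩
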